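/- **Setting.** Let $M$ be a compact connected Riemannian manifold (possibly with boundary or corners; $C^1$ with a continuous metric suffices), with Riemannian distance $\mathrm{dist}$ and Lebesgue (Riemannian volume) measure $\mathrm{Leb}$, let $f:M\to M$, and for a sequence $\xi=(x_k)_{k\ge0}$ in $M$ put $S_n(\xi)=\frac1{n+1}\sum_{k=0}^n\delta_{x_k}$; for $p\in M$ put $S_n(p)=S_n((f^k(p))_{k\ge 0})$. Let $\mu$ be an $f$-invariant Borel probability measure which is physical: $S_n(x)\to\mu$ in the weak* topology for Lebesgue-a.e. $x\in M$. Let $0<\varepsilon_0<\operatorname{diam}(M)/2$. For $0<\varepsilon<\varepsilon_0$ let $X_\varepsilon$ be a Markov chain on $M$ with transition probability $P_\varepsilon(x,dy)$ such that its realizations are $\varepsilon$-pseudotrajectories, i.e. for every $x$ one has $\mathrm{dist}(f(x),y)\le\varepsilon$ for $P_\varepsilon(x,\cdot)$-a.e. $y$. Assume that $X_\varepsilon$ has a unique ergodic stationary probability measure $\mu_\varepsilon$, where a stationary measure $\nu$ is called ergodic if $S_n(\bar x)\to\nu$ weak* for almost every realization $\bar x=(x_k)_{k\ge0}$ of the chain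 with initial distribution $\nu$. Let $\mathbb P_\varepsilon$ denote the law on $M^{\mathbb N}$ of $X_\varepsilon$ with initial distribution $\mu_\varepsilon$. Let $\mathcal B\subset L^1(M,\mathrm{Leb})$ be a linear space of functions $M\to\mathbb R$ (for instance a Banach space of functions), and let $\mathcal B_c=C(M)\cap\mathcal B$. Let $\sigma$ be a real function with $\sigma(\varepsilon)>0$ for $0<\varepsilon<\varepsilon_0$ and $\sigma(\varepsilon)\to0$ as $\varepsilon\to0^+$. **Theorem.** Suppose that $f$ is continuous and that 1. $f$ has stochastic stability with speed $\sigma$ for observables from $\mathcal B_c$: for every $\varphi\in\mathcal B_c$ there is a constant $C$ such that $\left|\int\varphi\,d\mu-\int\varphi\,d\mu_\varepsilon\right|\le C\sigma(\varepsilon)$ for all $0<\varepsilon<\varepsilon_0$; 2. $f$ has the specification property: for every $\eta>0$ there is $N\in\mathbb N$ such that for all $x_1,x_2\in M$ and all non-negative integers $a_1\le b_1$, $a_2\le b_2$, $p$ with $a_2-b_1>N$ and $p>b_2-a_1+N$ there is $x\in M$ with $f^p(x)=x$, $\mathrm{dist}(f^i(x),f^i(x_1))<\eta$ for $a_1\le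 i\le b_1$, and $\mathrm{dist}(f^i(x),f^i(x_2))<\eta$ for $a_2\le i\le b_2$; 3. $\mu$ is not a finite linear combination of Dirac measures; 4. for every $0<\varepsilon<\varepsilon_0$ the measure $\mu_\varepsilon$ has exponential decay of correlations for observables from $\mathcal B_c$: there is $\tau\in(0,1)$ such that for all $\tau'>\tau$ and $\varphi,\psi\in\mathcal B_c$ there is a constant $C$ with $$\left|\int\Big(\int\varphi(y)\,P^n_\varepsilon(x,dy)\Big)\psi(x)\,d\mu_\varepsilon(x)-\int\varphi\,d\mu_\varepsilon\int\psi\,d\mu_\varepsilon\right|\le C(\tau')^n\quad\text{for all } n\in\mathbb N,$$ where $P_\varepsilon^n$ is the $n$-step transition probability. Then $f$ has stochastic shadowing with accuracy $\sigma$ for observables from $\mathcal B_c$, with periodic shadowing points: for every $\varphi\in\mathcal B_c$ there is a constant $C$ such that for every $0<\varepsilon<\varepsilon_0$ there are measurable sets $B_N\subset M^{\mathbb N}$ ($N\in\mathbb N$) consisting of $\varepsilon$-pseudotrajectories of $f$, with $\mathbb P_\varepsilon(B_N)\to1$ as $N\to\infty$, such that for every $N$ and every $\bar x\in B_N$ there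 is a periodic point $p$ of $f$ satisfying, for all $n>N$, $$\left|\int\varphi\,dS_n(\bar x)-\int\varphi\,d\mu_\varepsilon\right|\le C\sigma(\varepsilon),\quad \left|\int\varphi\,dS_n(p)-\int\varphi\,d\mu\right|\le C\sigma(\varepsilon),\quad \left|\int\varphi\,dS_n(\bar x)-\int\varphi\,dS_n(p)\right|\le C\sigma(\varepsilon).$$ -/

import Mathlib

open MeasureTheory ProbabilityTheory Filter Topology Set Bundle
open scoped Manifold Bundle ENNReal ContDiff

noncomputable section

namespace StochasticShadowing

/-! ### Riemannian volume -/

section Volume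

variable {d : ℕ} {H : Type*} [TopologicalSpace H]
  (I : ModelWithCorners ℝ (EuclideanSpace ℝ (Fin d)) H)
  {M : Type*} [TopologicalSpace M] [ChartedSpace H M]
  [RiemannianBundle (fun x : M => TangentSpace I x)]

/-- The `i`-th coordinate vector `∂ᵢ` of the chart at `c`, at the point whose coordinates in this
chart are `y`. -/
def coordVector (c : M) (y : EuclideanSpace ℝ (Fin d)) (i : Fin d) :
    TangentSpace I ((extChartAt I c).symm y) :=
  mfderivWithin 𝓘(ℝ, EuclideanSpace ℝ (Fin d)) I (extChartAt I c).symm (range I) y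
    (EuclideanSpace.single i (1 : ℝ) : EuclideanSpace ℝ (Fin d))

/-- The volume density `√(det (g(∂ᵢ, ∂ⱼ)))` in the chart at `c`. -/
def volumeDensity (c : M) (y : EuclideanSpace ℝ (Fin d)) : ℝ :=
  √(Matrix.gram ℝ (coordVector I c y)).det

/-- The Riemannian volume of the domain of the chart at `c`, as a measure on `M`. -/
def chartVolume [MeasurableSpace M] (c : M) : Measure M :=
  ((volume.restrict (extChartAt I c).target).withDensity
    (fun y => ENNReal.ofReal (volumeDensity I c y))).map (extChartAt I c).symm

variable (M) in
/-- The Riemannian volume (the Lebesgue measure of the Riemannian manifold `M`). The measures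
`chartVolume I c` are its restrictions to the chart domains, which cover `M`, so it is their
supremum in the lattice of measures. -/
def riemannianVolume [MeasurableSpace M] : Measure M := ⨆ c : M, chartVolume I c

end Volume

/-! ### Empirical measures, typical points, physical measures -/

section Empirical

variable {M : Type*} [MeasurableSpace M]

/-- The empirical measure `Sₙ(x) = (n + 1)⁻¹ ∑_{k = 0}^{n} δ_{x_k}` of a sequence. -/
def empirical (x : ℕ → M) (n : ℕ) : Measure M :=
  ((n + 1 : ℕ) : ℝ≥0∞)⁻¹ • ∑ k ∈ Finset.range (n + 1), Measure.dirac (x k)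

instance (x : ℕ → M) (n : ℕ) : IsProbabilityMeasure (empirical x n) := by
  constructor
  simp only [empirical, Measure.smul_apply, Measure.finsetSum_apply, measure_univ,
    Finset.sum_const, Finset.card_range, smul_eq_mul, nsmul_eq_mul, mul_one]
  exact ENNReal.inv_mul_cancel (by simp) (by simp)

/-- The trajectory `p, f p, f² p, …`. -/
def orbit (f : M → M) (p : M) : ℕ → M := fun k => f^[k] p

/-- `Sₙ(x) → ν` in the weak-* topology. -/
def EmpiricallyConverges [TopologicalSpace M] [OpensMeasurableSpace M]
    (x : ℕ → M) (ν : ProbabilityMeasure M) : Prop :=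
  Tendsto (β := ProbabilityMeasure M) (fun n => ⟨empirical x n, inferInstance⟩) atTop (𝓝 ν)

/-- The measure `μ` is physical: Lebesgue-almost every point is `μ`-typical for `f`. -/
def IsPhysical [TopologicalSpace M] [OpensMeasurableSpace M]
    {d : ℕ} {H : Type*} [TopologicalSpace H]
    (I : ModelWithCorners ℝ (EuclideanSpace ℝ (Fin d)) H) [ChartedSpace H M]
    [RiemannianBundle (fun x : M => TangentSpace I x)]
    (f : M → M) (μ : ProbabilityMeasure M) : Prop :=
  ∀ᵐ x ∂(riemannianVolume I M), EmpiricallyConverges (orbit f x) μ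

/-- `μ` is a finite linear combination of Dirac measures. -/
def IsFiniteSumOfDiracs (μ : Measure M) : Prop :=
  ∃ (s : Finset M) (c : M → ℝ≥0∞), μ = ∑ x ∈ s, c x • Measure.dirac x

end Empirical

/-! ### Markov chains -/

section Chain

variable {M : Type*} [MeasurableSpace M]

/-- The conditional law of `X_{n+1}` given `X_0, …, X_n` for the time-homogeneous Markov chain with
transition probability `P`: it is `P (X_n, ·)`. -/
def stepKernel (P : Kernel M M) (n : ℕ) : Kernel ((i : Finset.Iic n) → M) M :=
  P.comap (fun h => h ⟨n, Finset.mem_Iic.2 le_rfl⟩) (measurable_pi_apply _)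

instance (P : Kernel M M) [IsMarkovKernel P] (n : ℕ) : IsMarkovKernel (stepKernel P n) := by
  unfold stepKernel; infer_instance

/-- The law, on the space of sequences, of the Markov chain with transition probability `P` and
initial distribution `ν`. -/
def pathLaw (P : Kernel M M) [IsMarkovKernel P] (ν : Measure M) : Measure (ℕ → M) :=
  (ν.map (fun x (_ : Finset.Iic 0) => x)).bind
    (Kernel.traj (X := fun _ => M) (stepKernel P) 0)

/-- The stationary measure `ν` is ergodic: `Sₙ(x̄) → ν` for almost every realization `x̄` of the
stationary chain. -/
def IsErgodicFor [TopologicalSpace M] [OpensMeasurableSpace M] (P : Kernel M M) [IsMarkovKernel P]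
    (ν : ProbabilityMeasure M) : Prop :=
  ∀ᵐ x ∂(pathLaw P (ν : Measure M)), EmpiricallyConverges x ν

/-- The stationary measure `ν` has exponential decay of correlations for observables from `𝒪`.
Here `P ^ n` is the `n`-step transition probability. -/
def HasExpDecay (P : Kernel M M) (ν : Measure M) (𝒪 : Set (M → ℝ)) : Prop :=
  ∃ τ : ℝ, 0 < τ ∧ τ < 1 ∧ ∀ τ' > τ, ∀ φ ∈ 𝒪, ∀ ψ ∈ 𝒪, ∃ C : ℝ, ∀ n : ℕ,
    |∫ x, (∫ y, φ y ∂((P ^ n) x)) * ψ x ∂ν - (∫ x, φ x ∂ν) * ∫ x, ψ x ∂ν| ≤ C * τ' ^ n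

end Chain

/-! ### Pseudotrajectories, specification, stochastic stability, stochastic shadowing -/

section Dynamics

variable {M : Type*} [MetricSpace M]

/-- `x` is an `ε`-pseudotrajectory of `f`. -/
def IsPseudotrajectory (f : M → M) (ε : ℝ) (x : ℕ → M) : Prop :=
  ∀ k, dist (f (x k)) (x (k + 1)) ≤ ε

/-- The realizations of the chain with transition probability `P` are `ε`-pseudotrajectories of
`f`: from `x` the chain jumps into the closed `ε`-ball around `f x`. -/
def IsAdmissible [MeasurableSpace M] (f : M → M) (ε : ℝ) (P : Kernel M M) : Prop :=
  ∀ x, ∀ᵐ y ∂(P x), dist (f x) y ≤ ε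

/-- The specification property (for two strings of times `[a₁, b₁]`, `[a₂, b₂]`); a point of period
`p` is a point fixed by `f^p`. -/
def HasSpecification (f : M → M) : Prop :=
  ∀ ε > 0, ∃ N : ℕ, ∀ x₁ x₂ : M, ∀ a₁ b₁ a₂ b₂ p : ℕ,
    a₁ ≤ b₁ → a₂ ≤ b₂ → b₁ + N < a₂ → b₂ + N < p + a₁ →
    ∃ x : M, Function.IsPeriodicPt f p x ∧
      (∀ i ∈ Icc a₁ b₁, dist (f^[i] x) (f^[i] x₁) < ε) ∧
      (∀ i ∈ Icc a₂ b₂, dist (f^[i] x) (f^[i] x₂) < ε)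

/-- The continuous functions belonging to the function space `𝔅`. -/
def continuousObservables (𝔅 : Submodule ℝ (M → ℝ)) : Set (M → ℝ) :=
  {φ | φ ∈ 𝔅 ∧ Continuous φ}

variable [MeasurableSpace M]

/-- Stochastic stability with speed `σ` for observables from `𝒪`. -/
def HasStochasticStability (μ : Measure M) (μs : ℝ → Measure M) (ε₀ : ℝ) (σ : ℝ → ℝ)
    (𝒪 : Set (M → ℝ)) : Prop :=
  ∀ φ ∈ 𝒪, ∃ C : ℝ, ∀ ε ∈ Ioo 0 ε₀, |∫ x, φ x ∂μ - ∫ x, φ x ∂(μs ε)| ≤ C * σ ε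

/-- Stochastic shadowing with accuracy `σ` for observables from `𝒪`, the shadowing points being
taken from the set `K`. The sets `B N` consist of realizations of the chain with transition
probability `P ε`, and their probability is computed for the chain started from `μs ε`. -/
def HasStochasticShadowing (f : M → M) (P : ℝ → Kernel M M) [∀ ε, IsMarkovKernel (P ε)]
    (μ : Measure M) (μs : ℝ → Measure M) (ε₀ : ℝ) (σ : ℝ → ℝ) (𝒪 : Set (M → ℝ))
    (K : Set M) : Prop :=
  ∀ φ ∈ 𝒪, ∃ C : ℝ, ∀ ε ∈ Ioo 0 ε₀, ∃ B : ℕ → Set (ℕ → M),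
    (∀ N, MeasurableSet (B N)) ∧
    (∀ N, ∀ x ∈ B N, IsPseudotrajectory f ε x ∧ ∃ p ∈ K, ∀ n > N,
      |∫ y, φ y ∂(empirical x n) - ∫ y, φ y ∂(μs ε)| ≤ C * σ ε ∧
      |∫ y, φ y ∂(empirical (orbit f p) n) - ∫ y, φ y ∂μ| ≤ C * σ ε ∧
      |∫ y, φ y ∂(empirical x n) - ∫ y, φ y ∂(empirical (orbit f p) n)| ≤ C * σ ε) ∧
    Tendsto (fun N => pathLaw (P ε) (μs ε) (B N)) atTop (𝓝 1)

end Dynamics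

end StochasticShadowing

end

open StochasticShadowing

/-!
The observable `φ` is fixed before the parameter `ε` and the set `B N`, so the shadowing points
only have to reproduce the space average of the single function `φ`, up to `σ ε > 0`, and the
time `N` after which they do so may depend on `ε`.

*Realizations.* Almost every realization of the chain is a pseudotrajectory
(`ae_isPseudotrajectory_pathLaw`), and by ergodicity the averages of `φ` along it converge to
`∫ φ ∂(μs ε)`. Hence the sets of pseudotrajectories whose averages are `σ ε`-close to
`∫ φ ∂(μs ε)` at all times `n > N` increase to a set of full probability. These are the sets `B N`
for `N ≥ N₀`, where `N₀` depends on `ε`; the finitely many others are taken to be empty.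

*Periodic points* (`exists_periodicPt_abs_birkhoffSum_le`). Let `ψ = φ - ∫ φ ∂μ`. By invariance the
`n`-th Birkhoff sum of `ψ` has mean zero, so it is nonnegative at some point `x₁` and nonpositive at
some point `x₂`. Follow the orbit of `x₁` up to time `i` and the orbit of `x₂` from time `i` to
time `n`: when `i` runs from `0` to `n`, the sum of `ψ` along this concatenation moves from a
nonpositive to a nonnegative value in steps of size at most `2 sup |ψ|`, so it is bounded by
`2 sup |ψ|` for a suitable `i`. The specification property yields a periodic point, of period
`n + O(1)`, that follows the concatenation outside `O(1)` times. Its average of `ψ` over a period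
is therefore small if `n` is large, and then so are its averages of `ψ` over all long enough times
(`eventually_abs_birkhoffSum_le_of_isPeriodicPt`).

The comparison of the two averages then follows from stochastic stability and the triangle
inequality.
-/

namespace StochasticShadowing

/-! ### Birkhoff sums -/

section Birkhoff

variable {α : Type*} {f : α → α} {ψ : α → ℝ} {K : ℝ}

lemma abs_birkhoffSum_le (hK : ∀ x, |ψ x| ≤ K) (n : ℕ) (x : α) :
    |birkhoffSum f ψ n x| ≤ n * K := by
  refine (Finset.abs_sum_le_sum_abs _ _).trans ?_
  refine (Finset.sum_le_card_nsmul _ _ K fun i _ => hK _).trans ?_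
  simp

lemma abs_birkhoffSum_sub_le {η : ℝ} {n : ℕ} {x y : α}
    (h : ∀ i < n, |ψ (f^[i] x) - ψ (f^[i] y)| ≤ η) :
    |birkhoffSum f ψ n x - birkhoffSum f ψ n y| ≤ n * η := by
  rw [birkhoffSum, birkhoffSum, ← Finset.sum_sub_distrib]
  refine (Finset.abs_sum_le_sum_abs _ _).trans ?_
  refine (Finset.sum_le_card_nsmul _ _ η fun i hi => h i (Finset.mem_range.1 hi)).trans ?_
  simp

lemma birkhoffSum_mul_of_isPeriodicPt {p : ℕ} {x : α} (hx : Function.IsPeriodicPt f p x) (q : ℕ) :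
    birkhoffSum f ψ (p * q) x = q * birkhoffSum f ψ p x := by
  induction q with
  | zero => simp
  | succ q ih =>
    rw [Nat.mul_succ, birkhoffSum_add, ih, (hx.mul_const q).eq]
    push_cast
    ring

/-- If the average of `ψ` over a period is less than `δ` in absolute value, then the averages over
all long enough times are at most `δ`: a time `n` consists of `n / p` full periods and a remainder
whose contribution is bounded. -/
lemma eventually_abs_birkhoffSum_le_of_isPeriodicPt (hK : ∀ x, |ψ x| ≤ K) {p : ℕ} (hp : 0 < p)
    {x : α} (hx : Function.IsPeriodicPt f p x) {δ : ℝ} (hδ : |birkhoffSum f ψ p x| < p * δ) :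
    ∃ N : ℕ, ∀ n ≥ N, |birkhoffSum f ψ n x| ≤ n * δ := by
  have hK0 : 0 ≤ K := (abs_nonneg _).trans (hK x)
  have hp' : (0 : ℝ) < p := by exact_mod_cast hp
  set A := |birkhoffSum f ψ p x| with hA
  have hA0 : 0 ≤ A := abs_nonneg _
  have hgap : 0 < p * δ - A := by linarith
  obtain ⟨N, hN⟩ := exists_nat_ge (p * (p * K) / (p * δ - A))
  refine ⟨N, fun n hn => ?_⟩
  have hn' : p * (p * K) ≤ n * (p * δ - A) := by
    rw [← div_le_iff₀ hgap]
    exact hN.trans (by exact_mod_cast hn)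
  have hsplit : birkhoffSum f ψ n x =
      (n / p : ℕ) * birkhoffSum f ψ p x + birkhoffSum f ψ (n % p) x := by
    conv_lhs => rw [← Nat.div_add_mod n p, birkhoffSum_add, (hx.mul_const _).eq,
      birkhoffSum_mul_of_isPeriodicPt hx]
  have hrem : |birkhoffSum f ψ (n % p) x| ≤ p * K :=
    (abs_birkhoffSum_le hK _ x).trans (by
      gcongr
      exact_mod_cast (Nat.mod_lt n hp).le)
  have hquot : |((n / p : ℕ) : ℝ) * birkhoffSum f ψ p x| ≤ n * A / p := by
    rw [abs_mul, Nat.abs_cast, ← hA, mul_div_right_comm]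
    gcongr
    exact Nat.cast_div_le
  rw [hsplit]
  refine (abs_add_le _ _).trans ((add_le_add hquot hrem).trans ?_)
  rw [← mul_le_mul_iff_right₀ hp', mul_add, mul_div_cancel₀ _ hp'.ne']
  linarith

/-- A discrete intermediate value theorem. -/
lemma exists_abs_le_of_abs_sub_le {h : ℕ → ℝ} {c : ℝ} (hc : 0 ≤ c)
    (hstep : ∀ i, |h (i + 1) - h i| ≤ c) (h0 : h 0 ≤ 0) {n : ℕ} (hn : 0 ≤ h n) :
    ∃ i ≤ n, |h i| ≤ c := by
  induction n with
  | zero => exact ⟨0, le_rfl, by rw [le_antisymm h0 hn]; simpa using hc⟩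
  | succ n ih =>
    rcases le_total 0 (h n) with h' | h'
    · obtain ⟨i, hi, hi'⟩ := ih h'
      exact ⟨i, hi.trans n.le_succ, hi'⟩
    · refine ⟨n + 1, le_rfl, ?_⟩
      rw [abs_of_nonneg hn]
      linarith [le_abs_self (h (n + 1) - h n), hstep n]

end Birkhoff

/-! ### Periodic points with prescribed averages -/

section Periodic

variable {M : Type*} [MetricSpace M] [CompactSpace M] {f : M → M} {ψ : M → ℝ}

/-- Two orbit segments can be concatenated, by the specification property, so that the Birkhoff sum
of `ψ` along the resulting periodic orbit is small compared with the period. -/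
lemma exists_isPeriodicPt_of_birkhoffSum_nonneg_of_nonpos (hspec : HasSpecification f)
    (hψ : Continuous ψ) (hpos : ∀ n, ∃ x, 0 ≤ birkhoffSum f ψ n x)
    (hneg : ∀ n, ∃ x, birkhoffSum f ψ n x ≤ 0) {δ : ℝ} (hδ : 0 < δ) :
    ∃ p > 0, ∃ x, Function.IsPeriodicPt f p x ∧ |birkhoffSum f ψ p x| < p * δ := by
  obtain ⟨K, hK⟩ : ∃ K, ∀ x, |ψ x| ≤ K := by
    obtain ⟨K, hK⟩ := isCompact_univ.exists_bound_of_continuousOn hψ.continuousOn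
    exact ⟨K, fun x => hK x (mem_univ x)⟩
  have hK0 : 0 ≤ K := (abs_nonneg _).trans (hK (hpos 0).choose)
  obtain ⟨r, hr, hψr⟩ := Metric.uniformContinuous_iff.1
    (CompactSpace.uniformContinuous_of_continuous hψ) (δ / 2) (half_pos hδ)
  obtain ⟨N, hN⟩ := hspec r hr
  -- `2 * K` bounds the sum along the concatenation, and the four sums over `N + 1` consecutive times
  -- by which it differs from the sum along the periodic orbit are at most `(N + 1) * K` each.
  obtain ⟨n, hn⟩ := exists_nat_ge ((2 * K + 4 * ((N + 1) * K)) / (δ / 2))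
  rw [div_le_iff₀ (half_pos hδ)] at hn
  obtain ⟨x₁, hx₁⟩ := hpos n
  obtain ⟨x₂, hx₂⟩ := hneg n
  obtain ⟨i, hin, hi⟩ := exists_abs_le_of_abs_sub_le
    (h := fun i => birkhoffSum f ψ i x₁ + (birkhoffSum f ψ n x₂ - birkhoffSum f ψ i x₂))
    (c := 2 * K) (n := n) (by positivity)
    (fun i => by
      have h₁ := abs_le.1 (hK (f^[i] x₁))
      have h₂ := abs_le.1 (hK (f^[i] x₂))
      simp only [birkhoffSum_succ]
      rw [abs_le]
      constructor <;> linarith)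
    (by simpa using hx₂) (by simpa using hx₁)
  obtain ⟨k, rfl⟩ := Nat.exists_eq_add_of_le hin
  obtain ⟨x, hxp, hxx₁, hxx₂⟩ := hN x₁ x₂ 0 i (i + (N + 1)) (i + (N + 1) + k)
    (i + (N + 1) + k + (N + 1)) (by lia) (by lia) (by lia) (by lia)
  refine ⟨_, by lia, x, hxp, ?_⟩
  have hclose₁ : |birkhoffSum f ψ i x - birkhoffSum f ψ i x₁| ≤ i * (δ / 2) :=
    abs_birkhoffSum_sub_le fun j hj => (hψr (hxx₁ j ⟨by lia, by lia⟩)).le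
  have hclose₂ : |birkhoffSum f ψ k (f^[i + (N + 1)] x) - birkhoffSum f ψ k (f^[i + (N + 1)] x₂)| ≤
      k * (δ / 2) :=
    abs_birkhoffSum_sub_le fun j hj => by
      simp only [← Function.iterate_add_apply]
      exact (hψr (hxx₂ _ ⟨by lia, by lia⟩)).le
  have hgap := fun y => abs_le.1 (abs_birkhoffSum_le (f := f) hK (N + 1) y)
  have hg₁ := hgap (f^[i] x)
  have hg₂ := hgap (f^[i + (N + 1) + k] x)
  have hg₃ := hgap (f^[i] x₂)
  have hg₄ := hgap (f^[i + k] x₂)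
  -- Both sides are the sum of `ψ` along the orbit of `x₂` up to time `i + k + (N + 1)`.
  have hx₂_split : birkhoffSum f ψ (i + k) x₂ + birkhoffSum f ψ (N + 1) (f^[i + k] x₂) =
      birkhoffSum f ψ i x₂ + birkhoffSum f ψ (N + 1) (f^[i] x₂) +
        birkhoffSum f ψ k (f^[i + (N + 1)] x₂) := by
    rw [← birkhoffSum_add, ← birkhoffSum_add, ← birkhoffSum_add]
    congr 1
    lia
  rw [abs_le] at hi hclose₁ hclose₂
  have hNδ : 0 < ((N : ℝ) + 1) * δ := by positivity
  simp only [birkhoffSum_add f ψ (i + (N + 1) + k), birkhoffSum_add f ψ (i + (N + 1)),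
    birkhoffSum_add f ψ i (N + 1)]
  push_cast at *
  rw [abs_lt]
  constructor <;> nlinarith only [hi, hclose₁, hclose₂, hg₁, hg₂, hg₃, hg₄, hx₂_split, hNδ, hn]

variable [MeasurableSpace M] [BorelSpace M]

/-- Under the specification property, the mean of a continuous function for an invariant measure is
approximated by its averages along a periodic orbit. -/
lemma exists_periodicPt_abs_birkhoffSum_le {μ : Measure M} [IsProbabilityMeasure μ]
    (hμ : MeasurePreserving f μ μ) (hf : Continuous f) (hspec : HasSpecification f)
    (hψ : Continuous ψ) (hψμ : ∫ x, ψ x ∂μ = 0) {δ : ℝ} (hδ : 0 < δ) :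
    ∃ x ∈ Function.periodicPts f, ∃ N : ℕ, ∀ n ≥ N, |birkhoffSum f ψ n x| ≤ n * δ := by
  have hcont : ∀ i : ℕ, Continuous fun x => ψ (f^[i] x) := fun i => hψ.comp (hf.iterate i)
  have hint : ∀ i : ℕ, Integrable (fun x => ψ (f^[i] x)) μ := fun i =>
    (hcont i).integrable_of_hasCompactSupport (HasCompactSupport.of_compactSpace _)
  have hint_sum : ∀ n : ℕ, Integrable (birkhoffSum f ψ n) μ := fun n =>
    integrable_finsetSum _ fun i _ => hint i
  have hmean : ∀ n : ℕ, ∫ x, birkhoffSum f ψ n x ∂μ = 0 := fun n => by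
    simp only [birkhoffSum]
    rw [integral_finsetSum _ fun i _ => hint i]
    refine Finset.sum_eq_zero fun i _ => ?_
    rw [← hψμ, ← (hμ.iterate i).map_eq,
      integral_map (hμ.iterate i).aemeasurable hψ.aestronglyMeasurable, (hμ.iterate i).map_eq]
  obtain ⟨p, hp, x, hx, hpx⟩ := exists_isPeriodicPt_of_birkhoffSum_nonneg_of_nonpos hspec hψ
    (fun n => by simpa only [hmean] using exists_integral_le (hint_sum n))
    (fun n => by simpa only [hmean] using exists_le_integral (hint_sum n)) hδ
  obtain ⟨K, hK⟩ := isCompact_univ.exists_bound_of_continuousOn hψ.continuousOn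
  exact ⟨x, ⟨p, hp, hx⟩, eventually_abs_birkhoffSum_le_of_isPeriodicPt
    (fun y => hK y (mem_univ y)) hp hx hpx⟩

end Periodic

/-! ### Realizations of the chain -/

section Realizations

lemma integral_empirical {M : Type*} [TopologicalSpace M] [CompactSpace M] [MeasurableSpace M]
    [OpensMeasurableSpace M] {φ : M → ℝ} (hφ : Continuous φ) (x : ℕ → M) (n : ℕ) :
    ∫ y, φ y ∂(empirical x n) = ((n + 1 : ℕ) : ℝ)⁻¹ * ∑ k ∈ Finset.range (n + 1), φ (x k) := by
  have hsm : StronglyMeasurable φ :=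
    hφ.stronglyMeasurable_of_hasCompactSupport (HasCompactSupport.of_compactSpace _)
  rw [empirical, integral_smul_measure, integral_finsetSum_measure]
  · have hn : ((n : ℝ≥0∞) + 1).toReal = n + 1 := by
      exact_mod_cast ENNReal.toReal_natCast (n + 1)
    simp [integral_dirac' _ _ hsm, hn]
  · exact fun k _ => integrable_dirac' hsm (by simp)

instance {M : Type*} [MeasurableSpace M] (P : Kernel M M) [IsMarkovKernel P] (ν : Measure M)
    [IsProbabilityMeasure ν] : IsProbabilityMeasure (pathLaw P ν) := by
  have : IsProbabilityMeasure (ν.map (fun x (_ : Finset.Iic 0) => x)) :=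
    Measure.isProbabilityMeasure_map (by fun_prop)
  unfold pathLaw
  infer_instance

variable {M : Type*} [MetricSpace M] [CompactSpace M] [MeasurableSpace M] [BorelSpace M]
  {f : M → M} {ε : ℝ}

lemma measurableSet_isPseudotrajectory (hf : Continuous f) (ε : ℝ) :
    MeasurableSet {x : ℕ → M | IsPseudotrajectory f ε x} := by
  simp only [IsPseudotrajectory, ofPred_forall]
  have := hf.measurable
  exact MeasurableSet.iInter fun k => measurableSet_le (by fun_prop) measurable_const

lemma ae_isPseudotrajectory_pathLaw (hf : Continuous f) {P : Kernel M M} [IsMarkovKernel P]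
    (hP : IsAdmissible f ε P) (ν : Measure M) :
    ∀ᵐ x ∂(pathLaw P ν), IsPseudotrajectory f ε x := by
  have hfm := hf.measurable
  simp only [IsPseudotrajectory]
  rw [ae_all_iff]
  intro k
  have hmeas : MeasurableSet {x : ℕ → M | dist (f (x k)) (x (k + 1)) ≤ ε} :=
    measurableSet_le (by fun_prop) measurable_const
  rw [pathLaw, Measure.ae_comp_iff hmeas]
  refine .of_forall fun h => ?_
  -- Condition on the first `k + 1` states `h'`; the next one then has law `P (h' k)`.
  rw [← Kernel.traj_comp_partialTraj (Nat.zero_le k), Kernel.ae_comp_iff hmeas]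
  refine .of_forall fun h' => ?_
  have hpast : ∀ᵐ x ∂(Kernel.traj (X := fun _ => M) (stepKernel P) k h'),
      @Preorder.frestrictLe ℕ _ (fun _ => M) _ k x = h' := by
    refine ae_of_ae_map (p := fun y : Finset.Iic k → M => y = h')
      (Preorder.measurable_frestrictLe (X := fun _ => M) k).aemeasurable ?_
    rw [Kernel.traj_map_frestrictLe_apply, Kernel.partialTraj_self, Kernel.id_apply,
      ae_dirac_eq]
    exact Filter.eventually_pure.2 rfl
  have hnext : ∀ᵐ x ∂(Kernel.traj (X := fun _ => M) (stepKernel P) k h'),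
      dist (f (h' ⟨k, Finset.mem_Iic.2 le_rfl⟩)) (x (k + 1)) ≤ ε := by
    have := hP (h' ⟨k, Finset.mem_Iic.2 le_rfl⟩)
    have hlaw : (Kernel.traj (X := fun _ => M) (stepKernel P) k h').map (fun x => x (k + 1)) =
        P (h' ⟨k, Finset.mem_Iic.2 le_rfl⟩) := by
      rw [← Kernel.map_apply _ (by fun_prop), Kernel.map_traj_succ_self]
      rfl
    rw [← hlaw] at this
    exact ae_of_ae_map (measurable_pi_apply _).aemeasurable this
  filter_upwards [hpast, hnext] with x hx hx'
  rw [← hx] at hx'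
  exact hx'

/-- The realizations that are pseudotrajectories and along which the averages of `φ` are `δ`-close
to the space average at all times after `N` have probability tending to one as `N → ∞`. -/
lemma tendsto_pathLaw_abs_integral_empirical_sub_le (hf : Continuous f) {P : Kernel M M}
    [IsMarkovKernel P] (hP : IsAdmissible f ε P) {ν : ProbabilityMeasure M}
    (hν : IsErgodicFor P ν) {φ : M → ℝ} (hφ : Continuous φ) {δ : ℝ} (hδ : 0 < δ) :
    Tendsto (fun N => pathLaw P (ν : Measure M) {x | IsPseudotrajectory f ε x ∧
      ∀ n > N, |∫ y, φ y ∂(empirical x n) - ∫ y, φ y ∂(ν : Measure M)| ≤ δ}) atTop (𝓝 1) := by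
  set E : ℕ → Set (ℕ → M) := fun N => {x | IsPseudotrajectory f ε x ∧
    ∀ n > N, |∫ y, φ y ∂(empirical x n) - ∫ y, φ y ∂(ν : Measure M)| ≤ δ}
  have hmono : Monotone E := fun N N' hN x hx => ⟨hx.1, fun n hn => hx.2 n (hN.trans_lt hn)⟩
  have hfull : pathLaw P (ν : Measure M) (⋃ N, E N) = 1 := by
    rw [measure_congr (eventuallyEq_univ.2 ?_), measure_univ]
    filter_upwards [ae_isPseudotrajectory_pathLaw hf hP (ν : Measure M), hν] with x hx hxν
    have hlim := ProbabilityMeasure.tendsto_iff_forall_integral_tendsto.1 hxν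
      (BoundedContinuousFunction.mkOfCompact ⟨φ, hφ⟩)
    obtain ⟨N, hN⟩ := Metric.tendsto_atTop.1 hlim δ hδ
    exact mem_iUnion.2 ⟨N, hx, fun n hn => (hN n hn.le).le⟩
  rw [← hfull]
  exact tendsto_measure_iUnion_atTop hmono

lemma measurableSet_abs_integral_empirical_sub_le {φ : M → ℝ} (hφ : Continuous φ) (c δ : ℝ)
    (N : ℕ) :
    MeasurableSet {x : ℕ → M | ∀ n > N, |∫ y, φ y ∂(empirical x n) - c| ≤ δ} := by
  have := hφ.measurable
  simp only [integral_empirical hφ, ofPred_forall]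
  exact MeasurableSet.iInter fun n => MeasurableSet.iInter fun _ =>
    measurableSet_le (by fun_prop) measurable_const

end Realizations

end StochasticShadowing

open StochasticShadowing

theorem mainTheorem3
    -- `M` is a compact Riemannian manifold, possibly with boundary
    {d : ℕ} {H : Type*} [TopologicalSpace H]
    (I : ModelWithCorners ℝ (EuclideanSpace ℝ (Fin d)) H)
    {M : Type*} [MetricSpace M] [CompactSpace M] [ChartedSpace H M] [IsManifold I 1 M]
    [RiemannianBundle (fun x : M => TangentSpace I x)]
    [IsContinuousRiemannianBundle (EuclideanSpace ℝ (Fin d)) (fun x : M => TangentSpace I x)]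
    [IsRiemannianManifold I M]
    [MeasurableSpace M] [BorelSpace M]
    -- the map and its physical measure
    (f : M → M) (μ : ProbabilityMeasure M)
    (hμ_inv : MeasurePreserving f (μ : Measure M) (μ : Measure M))
    (hμ_phys : IsPhysical I f μ)
    -- an admissible family of Markov chains, with unique ergodic stationary measures
    (ε₀ : ℝ) (hε₀ : 0 < ε₀) (hε₀_diam : ε₀ < Metric.diam (univ : Set M) / 2)
    (P : ℝ → Kernel M M) [∀ ε, IsMarkovKernel (P ε)]
    (hP : ∀ ε ∈ Ioo 0 ε₀, IsAdmissible f ε (P ε))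
    (μs : ℝ → ProbabilityMeasure M)
    (hμs_stat : ∀ ε ∈ Ioo 0 ε₀, Kernel.Invariant (P ε) (μs ε : Measure M))
    (hμs_erg : ∀ ε ∈ Ioo 0 ε₀, IsErgodicFor (P ε) (μs ε))
    (hμs_unique : ∀ ε ∈ Ioo 0 ε₀, ∀ ν : ProbabilityMeasure M,
      Kernel.Invariant (P ε) (ν : Measure M) → IsErgodicFor (P ε) ν → ν = μs ε)
    -- the space of observables
    (𝔅 : Submodule ℝ (M → ℝ)) (h𝔅 : ∀ φ ∈ 𝔅, Integrable φ (riemannianVolume I M))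
    -- the speed
    (σ : ℝ → ℝ) (hσ_pos : ∀ ε ∈ Ioo 0 ε₀, 0 < σ ε) (hσ : Tendsto σ (𝓝[>] 0) (𝓝 0))
    -- the hypotheses on the system
    (hf : Continuous f)
    (hstab : HasStochasticStability (μ : Measure M) (fun ε => (μs ε : Measure M)) ε₀ σ
      (continuousObservables 𝔅))
    (hspec : HasSpecification f)
    (hμ_dirac : ¬ IsFiniteSumOfDiracs (μ : Measure M))
    (hdecay : ∀ ε ∈ Ioo 0 ε₀, HasExpDecay (P ε) (μs ε : Measure M) (continuousObservables 𝔅)) :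
    HasStochasticShadowing f P (μ : Measure M) (fun ε => (μs ε : Measure M)) ε₀ σ
      (continuousObservables 𝔅) (Function.periodicPts f) := by
  intro φ hφ
  obtain ⟨C, hC⟩ := hstab φ hφ
  have hφc : Continuous φ := hφ.2
  -- Each time average is `σ ε`-close to its space average; these differ by at most `C * σ ε`.
  refine ⟨|C| + 2, fun ε hε => ?_⟩
  have hσε : 0 < σ ε := hσ_pos ε hε
  have hσC : σ ε ≤ (|C| + 2) * σ ε := by nlinarith [abs_nonneg C]
  have hφint : Integrable φ (μ : Measure M) :=
    hφc.integrable_of_hasCompactSupport (HasCompactSupport.of_compactSpace _)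
  obtain ⟨p, hp, N₀, hN₀⟩ := exists_periodicPt_abs_birkhoffSum_le hμ_inv hf hspec
    (ψ := fun x => φ x - ∫ y, φ y ∂(μ : Measure M)) (by fun_prop)
    (by rw [integral_sub hφint (integrable_const _)]; simp) hσε
  have hp_avg : ∀ n ≥ N₀,
      |∫ y, φ y ∂(empirical (orbit f p) n) - ∫ y, φ y ∂(μ : Measure M)| ≤ σ ε := fun n hn => by
    have h := hN₀ (n + 1) (by lia)
    have hn0 : (0 : ℝ) < (n + 1 : ℕ) := by positivity
    rw [integral_empirical hφc, ← mul_le_mul_iff_right₀ hn0]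
    nth_rw 1 [← abs_of_pos hn0]
    rw [← abs_mul, mul_sub, mul_inv_cancel_left₀ hn0.ne']
    simpa [birkhoffSum, orbit] using h
  refine ⟨fun N => {x | N₀ ≤ N ∧ IsPseudotrajectory f ε x ∧
    ∀ n > N, |∫ y, φ y ∂(empirical x n) - ∫ y, φ y ∂(μs ε : Measure M)| ≤ σ ε}, fun N => ?_,
    fun N x hx => ⟨hx.2.1, p, hp, fun n hn => ?_⟩, ?_⟩
  · exact (MeasurableSet.const _).inter ((measurableSet_isPseudotrajectory hf ε).inter
      (measurableSet_abs_integral_empirical_sub_le hφc _ _ N))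
  · have h₁ := hx.2.2 n hn
    have h₂ := hp_avg n (hx.1.trans hn.le)
    have h₃ := (hC ε hε).trans (mul_le_mul_of_nonneg_right (le_abs_self C) hσε.le)
    refine ⟨h₁.trans hσC, h₂.trans hσC, ?_⟩
    rw [abs_le] at *
    constructor <;> linarith
  · refine (tendsto_pathLaw_abs_integral_empirical_sub_le hf (hP ε hε) (hμs_erg ε hε) hφc
      hσε).congr' ?_
    filter_upwards [eventually_ge_atTop N₀] with N hN
    simp only [hN, true_and]
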